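/- Let $\alpha,\beta$ be real numbers with $\alpha\ge\beta\ge-\frac12$ and $\alpha>-\frac12$, and put $\rho=\alpha+\beta+1$. Let $\mu$ be the measure on $(0,\infty)$ with density $A(x)=(2\sinh x)^{2\alpha+1}(2\cosh x)^{2\beta+1}$ with respect to Lebesgue measure. For $\lambda\in\mathbb C$ let $$\varphi_\lambda(x)={}_2F_1\bigl(\tfrac12(\rho-i\lambda),\tfrac12(\rho+i\lambda);\alpha+1;-\sinh^2x\bigr)$$ be the Jacobi function of order $(\alpha,\beta)$, where ${}_2F_1$ is the Gaussian hypergeometric function (the analytic continuation of the Gauss series). For $1\le p<\infty$ let $$S_p=\{\lambda\in\mathbb C:\ |\operatorname{Im}\lambda|\le|1-\tfrac2p|\,\rho\},$$ with interior $S_p^\circ$ and boundary $\partial S_p$. For a measurable function $f$ on $(0,\infty)$ put $f^*(t)=\inf\{s>0:\mu(\{|f|>s\})\le t\}$ for $t>0$ (with $\inf\emptyset=\infty$), and let $L^{r,q}(\mu)$ be the space of measurable $f$ for which $\|f\|_{r,q}<\infty$, where $$\|f\|_{r,q}=\Bigl(\frac qr\int_0^\infty\bigl(s^{1/r}f^*(s)\bigr)^q\,\frac{ds}s\Bigr)^{1/q}\quad(1\le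 r<\infty,\ 1\le q<\infty),\qquad \|f\|_{r,\infty}=\sup_{s>0}s^{1/r}f^*(s)\quad(1\le r\le\infty),$$ so that $L^{\infty,\infty}(\mu)=L^\infty(\mu)$. Let $p'$ denote the conjugate exponent of $p$, $\frac1p+\frac1{p'}=1$ (so $1'=\infty$). Then: (i) if $1<p<2$ and $\lambda\in S_p^\circ$, then $\varphi_\lambda\in L^{p',q}(\mu)$ for every $q\in[1,\infty]$; (ii) if $1\le p<2$ and $\lambda\in\partial S_p$, then $\varphi_\lambda\in L^{p',\infty}(\mu)$; (iii) if $\lambda$ is real, then the function $x\mapsto\varphi_\lambda(x)/(1+x)$ belongs to $L^{2,\infty}(\mu)$. -/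

import Mathlib

open Set Filter Topology MeasureTheory
open scoped ENNReal

/-- The Gaussian hypergeometric function `₂F₁(a, b; c; z)` on the half-plane `Re z < 1/2`, i.e. the
analytic continuation to it of the Gauss series (Mathlib's `ordinaryHypergeometric`, which is `0`
outside the disc of convergence).  The explicit formula evaluates a Gauss series at `z / (z - 1)`,
a point of the unit disc.  That it is the analytic continuation is proved below, in
`differentiableOn_hypergeometricContinuation` and `hypergeometricContinuation_eq`. -/
noncomputable def hypergeometricContinuation (a b c z : ℂ) : ℂ :=
  (1 - z) ^ (-a) * ordinaryHypergeometric a (c - b) c (z / (z - 1))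

theorem summable_hypergeometric_coeff {a b c : ℂ} (hc : ∀ k : ℕ, c ≠ -k) {r : ℝ}
    (hr0 : 0 ≤ r) (hr : r < 1) :
    Summable (fun n : ℕ => ‖ordinaryHypergeometricCoefficient a b c n‖ * r ^ n) := by
  have h1 := Complex.radius_regularizedGaussHGFunSeries_ge_one a b c
  lift r to NNReal using hr0
  have h2 : (r : ℝ≥0∞) < (Complex.regularizedGaussHGFunSeries a b c).radius :=
    lt_of_lt_of_le (by exact_mod_cast hr) h1
  have h3 := (Complex.regularizedGaussHGFunSeries a b c).summable_norm_mul_pow h2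
  have hG : Complex.Gamma c ≠ 0 := Complex.Gamma_ne_zero hc
  refine (h3.mul_left ‖Complex.Gamma c‖).congr fun n => ?_
  have h4 := Complex.Gamma_inv_mul_ordinaryHypergeometricSeries_eq (a := a) (b := b) hc (n := n)
  rw [ordinaryHypergeometricSeries, FormalMultilinearSeries.coeff_ofScalars] at h4
  rw [FormalMultilinearSeries.norm_apply_eq_norm_coef, ← h4, norm_mul, norm_inv]
  have : ‖Complex.Gamma c‖ ≠ 0 := norm_ne_zero_iff.2 hG
  field_simp

theorem hasDerivAt_powerSeries {u : ℕ → ℂ}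
    (hu : ∀ r : ℝ, 0 ≤ r → r < 1 → Summable (fun n : ℕ => ‖u n‖ * r ^ n)) {z : ℂ} (hz : ‖z‖ < 1) :
    HasSum (fun n : ℕ => ((n : ℂ) + 1) * u (n + 1) * z ^ n)
      (deriv (fun w => ∑' n : ℕ, u n * w ^ n) z) ∧
    HasDerivAt (fun w => ∑' n : ℕ, u n * w ^ n) (deriv (fun w => ∑' n : ℕ, u n * w ^ n) z) z := by
  obtain ⟨r, hzr, hr⟩ := exists_between hz
  have hr0 : 0 ≤ r := (norm_nonneg z).trans hzr.le
  have hmem : z ∈ Metric.ball (0 : ℂ) r := by simpa using hzr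
  have hd : ∀ n : ℕ, DifferentiableOn ℂ (fun w : ℂ => u n * w ^ n) (Metric.ball 0 r) :=
    fun n => by fun_prop
  have hle : ∀ (n : ℕ) (w : ℂ), w ∈ Metric.ball (0 : ℂ) r → ‖u n * w ^ n‖ ≤ ‖u n‖ * r ^ n := by
    intro n w hw
    rw [norm_mul, norm_pow]
    have : ‖w‖ ≤ r := by simpa using (mem_ball_zero_iff.1 hw).le
    gcongr
  constructor
  · have h := Complex.hasSum_deriv_of_summable_norm (hu r hr0 hr) hd Metric.isOpen_ball hle hmem
    rw [← hasSum_nat_add_iff' 1] at h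
    simpa [mul_assoc, mul_comm, mul_left_comm] using h
  · exact ((Complex.differentiableOn_tsum_of_summable_norm (hu r hr0 hr) hd Metric.isOpen_ball
      hle).differentiableAt (Metric.isOpen_ball.mem_nhds hmem)).hasDerivAt

theorem summable_derivative_coeff {u : ℕ → ℂ}
    (hu : ∀ r : ℝ, 0 ≤ r → r < 1 → Summable (fun n : ℕ => ‖u n‖ * r ^ n)) (r : ℝ) (hr0 : 0 ≤ r)
    (hr : r < 1) : Summable (fun n : ℕ => ‖((n : ℂ) + 1) * u (n + 1)‖ * r ^ n) := by
  have h := (hasDerivAt_powerSeries hu (z := (r : ℂ)) (by simpa [abs_of_nonneg hr0])).1.summable.norm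
  refine h.congr fun n => ?_
  rw [norm_mul, norm_pow]
  simp [abs_of_nonneg hr0]

theorem hasSum_mul_var {u : ℕ → ℂ} {z S : ℂ}
    (h : HasSum (fun n : ℕ => ((n : ℂ) + 1) * u (n + 1) * z ^ n) S) :
    HasSum (fun n : ℕ => (n : ℂ) * u n * z ^ n) (z * S) := by
  rw [← hasSum_nat_add_iff' 1]
  simp only [Finset.range_one, Finset.sum_singleton, Nat.cast_zero, zero_mul, sub_zero]
  refine (h.mul_left z).congr_fun ?_ 
  intro n
  push_cast
  ring

/-- The hypergeometric differential equation for the Gauss series on the unit disc. -/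
theorem ordinaryHypergeometric_ode {a b c : ℂ} (hc : ∀ k : ℕ, c ≠ -k) :
    ∃ h1 h2 : ℂ → ℂ, ∀ z : ℂ, ‖z‖ < 1 →
      HasDerivAt (fun w : ℂ => ordinaryHypergeometric a b c w) (h1 z) z ∧ HasDerivAt h1 (h2 z) z ∧
      z * (1 - z) * h2 z + (c - (a + b + 1) * z) * h1 z
        - a * b * ordinaryHypergeometric a b c z = 0 := by
  set u : ℕ → ℂ := ordinaryHypergeometricCoefficient a b c with hu_def
  have hrec : ∀ n : ℕ, ((n : ℂ) + c) * (((n : ℂ) + 1) * u (n + 1)) = (a + n) * (b + n) * u n := by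
    intro n
    have hcn : ∀ n : ℕ, (ascPochhammer ℂ n).eval c ≠ 0 := by
      intro n hn
      obtain ⟨k, -, hk⟩ := (ascPochhammer_eval_eq_zero_iff _ _).1 hn
      exact hc k (by rw [hk]; ring)
    have h1 := hcn n
    have h2 : c + n ≠ 0 := fun h => hc n (by linear_combination h)
    have h3 : ((n.factorial : ℕ) : ℂ) ≠ 0 := by exact_mod_cast n.factorial_ne_zero
    have h4 : (n : ℂ) + 1 ≠ 0 := by exact_mod_cast n.succ_ne_zero
    simp only [hu_def, ordinaryHypergeometricCoefficient, ascPochhammer_succ_eval,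
      Nat.factorial_succ]
    push_cast
    field_simp
    ring
  have hF : ∀ w : ℂ, ordinaryHypergeometric a b c w = ∑' n : ℕ, u n * w ^ n := by
    intro w
    rw [ordinaryHypergeometric_eq_tsum]
    rfl
  have s0 : ∀ r : ℝ, 0 ≤ r → r < 1 → Summable (fun n : ℕ => ‖u n‖ * r ^ n) :=
    fun r h0 h1 => summable_hypergeometric_coeff hc h0 h1
  set v : ℕ → ℂ := fun n => ((n : ℂ) + 1) * u (n + 1) with hv
  have s1 : ∀ r : ℝ, 0 ≤ r → r < 1 → Summable (fun n : ℕ => ‖v n‖ * r ^ n) :=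
    summable_derivative_coeff s0
  refine ⟨fun z => ∑' n : ℕ, v n * z ^ n, deriv (fun z => ∑' n : ℕ, v n * z ^ n), fun z hz => ?_⟩
  obtain ⟨A1, A2⟩ := hasDerivAt_powerSeries s0 hz
  obtain ⟨B1, B2⟩ := hasDerivAt_powerSeries s1 hz
  have e1 : deriv (fun w => ∑' n : ℕ, u n * w ^ n) z = ∑' n : ℕ, v n * z ^ n := A1.tsum_eq.symm
  rw [e1] at A1 A2
  simp only [hF]
  refine ⟨A2, B2, ?_⟩
  have H0 : HasSum (fun n : ℕ => u n * z ^ n) (∑' n : ℕ, u n * z ^ n) := by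
    refine Summable.hasSum (Summable.of_norm ?_)
    simpa [norm_mul, norm_pow] using s0 ‖z‖ (norm_nonneg z) hz
  have H1 := hasSum_mul_var A1
  have H2 := hasSum_mul_var B1
  have H3 : HasSum (fun n : ℕ => (n : ℂ) * (((n : ℂ) - 1) * u n) * z ^ n)
      (z * (z * deriv (fun z => ∑' n : ℕ, v n * z ^ n) z)) := by
    refine hasSum_mul_var (u := fun n => ((n : ℂ) - 1) * u n) ?_
    convert H2 using 2 with n
    simp only [hv]
    push_cast
    ring
  have T := (((H2.sub H3).add (A1.mul_left c)).sub (H1.mul_left (a + b + 1))).sub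
    (H0.mul_left (a * b))
  have T0 := T.unique (a₂ := 0) (by
    convert hasSum_zero with n
    simp only [hv]
    linear_combination (z ^ n) * hrec n)
  linear_combination T0

theorem norm_div_sub_one_lt {z : ℂ} (hz : z.re < 1 / 2) : ‖z / (z - 1)‖ < 1 := by
  have h1 : z - 1 ≠ 0 := by
    intro h
    have : z = 1 := sub_eq_zero.1 h
    rw [this] at hz
    norm_num at hz
  rw [norm_div, div_lt_one (norm_pos_iff.2 h1)]
  rw [← sq_lt_sq₀ (norm_nonneg _) (norm_nonneg _), Complex.sq_norm, Complex.sq_norm,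
    Complex.normSq_apply, Complex.normSq_apply]
  simp
  nlinarith

/-- The same equation for the continued function, on the half-plane `Re z < 1/2`. -/
theorem hypergeometricContinuation_ode {a b c : ℂ} (hc : ∀ k : ℕ, c ≠ -k) :
    ∃ g1 g2 : ℂ → ℂ, ∀ z : ℂ, z.re < 1 / 2 →
      HasDerivAt (hypergeometricContinuation a b c) (g1 z) z ∧ HasDerivAt g1 (g2 z) z ∧
      z * (1 - z) * g2 z + (c - (a + b + 1) * z) * g1 z
        - a * b * hypergeometricContinuation a b c z = 0 := by
  obtain ⟨h1, h2, H⟩ := ordinaryHypergeometric_ode (a := a) (b := c - b) hc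
  set E : ℂ → ℂ := fun z => (1 - z) ^ (-a) with hE
  set F : ℂ → ℂ := fun w => ordinaryHypergeometric a (c - b) c w with hF
  refine ⟨fun z => E z * (a * F (z / (z - 1)) / (1 - z) - h1 (z / (z - 1)) / (1 - z) ^ 2),
    fun z => E z * (a / (1 - z) *
      (a * F (z / (z - 1)) / (1 - z) - h1 (z / (z - 1)) / (1 - z) ^ 2) +
      (a * F (z / (z - 1)) / (1 - z) ^ 2 - a * h1 (z / (z - 1)) / (1 - z) ^ 3
        - 2 * h1 (z / (z - 1)) / (1 - z) ^ 3 + h2 (z / (z - 1)) / (1 - z) ^ 4)), fun z hz => ?_⟩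
  obtain ⟨D1, D2, D3⟩ := H _ (norm_div_sub_one_lt hz)
  have ht : 0 < (1 - z).re := by simp; linarith
  have hz1 : 1 - z ≠ 0 := fun h => by rw [h] at ht; simp at ht
  have hz2 : z - 1 ≠ 0 := fun h => hz1 (by linear_combination -h)
  have dt : HasDerivAt (fun z : ℂ => 1 - z) (-1) z := (hasDerivAt_id z).const_sub 1
  have dw : HasDerivAt (fun z : ℂ => z / (z - 1)) (-1 / (1 - z) ^ 2) z := by
    convert! (hasDerivAt_id z).div ((hasDerivAt_id z).sub_const 1) hz2 using 1
    have : (1 - z) ^ 2 = (z - 1) ^ 2 := by ring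
    simp only [id]
    rw [this]; ring
  have dE : HasDerivAt E (a * E z / (1 - z)) z := by
    convert! dt.cpow_const (c := -a) (Or.inl ht) using 1
    rw [Complex.cpow_sub _ _ hz1, Complex.cpow_one]
    simp only [hE]; ring
  have dF := D1.comp z dw
  have dh := D2.comp z dw
  simp only [Function.comp_def] at dF dh
  refine ⟨?_, ?_, ?_⟩
  · convert! dE.mul dF using 1
    field_simp
    ring
  · convert! dE.mul (((dF.const_mul a).div dt hz1).sub (dh.div (dt.pow 2) (pow_ne_zero 2 hz1)))
      using 1
    simp
    field_simp
    ring
  · have hw : z / (z - 1) = - z / (1 - z) := by field_simp; ring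
    have D4 : (-z / (1 - z)) * (1 - (-z / (1 - z))) * h2 (z / (z - 1)) +
      (c - (a + (c - b) + 1) * (-z / (1 - z))) * h1 (z / (z - 1))
        - a * (c - b) * F (z / (z - 1)) = 0 := by
      rw [← hw]; exact D3
    change _ - a * b * (E z * F (z / (z - 1))) = 0
    field_simp at D4 ⊢
    linear_combination (-E z) * D4

/-- A solution analytic at `0` and vanishing there is zero near `0`. -/
theorem eventually_eq_zero_of_hypergeometric_ode {a b c : ℂ} (hc : ∀ k : ℕ, c ≠ -k)
    {f f1 f2 : ℂ → ℂ} (hf : AnalyticAt ℂ f 0) (hf0 : f 0 = 0)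
    (h : ∀ᶠ z in 𝓝 (0 : ℂ), HasDerivAt f (f1 z) z ∧ HasDerivAt f1 (f2 z) z ∧
      z * (1 - z) * f2 z + (c - (a + b + 1) * z) * f1 z - a * b * f z = 0) :
    ∀ᶠ z in 𝓝 (0 : ℂ), f z = 0 := by
  by_contra hne
  obtain ⟨n, g, hg, hg0, hfg⟩ := hf.exists_eventuallyEq_pow_smul_nonzero_iff.2 hne
  simp only [sub_zero, smul_eq_mul] at hfg
  obtain _ | m := n
  · have := hfg.self_of_nhds
    simp [hf0] at this
    exact hg0 this.symm
  set k : ℂ → ℂ := fun z => ((m : ℂ) + 1) * g z + z * deriv g z with hk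
  have hka : AnalyticAt ℂ k 0 := by
    have := hg.deriv
    fun_prop
  have e1 : ∀ᶠ z in 𝓝 (0 : ℂ), f1 z = z ^ m * k z := by
    filter_upwards [h, hfg.eventually_nhds, hg.eventually_analyticAt] with z hz hz2 hz3
    have d1 : HasDerivAt (fun z => z ^ (m + 1) * g z) (f1 z) z :=
      hz.1.congr_of_eventuallyEq (hz2.mono fun _ h => h.symm)
    rw [d1.unique ((hasDerivAt_pow (m + 1) z).mul hz3.differentiableAt.hasDerivAt)]
    simp only [hk]
    push_cast
    ring
  have e2 : ∀ᶠ z in 𝓝 (0 : ℂ), z * f2 z = z ^ m * (m * k z + z * deriv k z) := by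
    filter_upwards [h, e1.eventually_nhds, hka.eventually_analyticAt] with z hz hz2 hz3
    have d1 : HasDerivAt (fun z => z ^ m * k z) (f2 z) z :=
      hz.2.1.congr_of_eventuallyEq (hz2.mono fun _ h => h.symm)
    rw [d1.unique ((hasDerivAt_pow m z).mul hz3.differentiableAt.hasDerivAt)]
    rcases m with _ | m
    · simp
    · push_cast
      ring
  set R : ℂ → ℂ := fun z => (1 - z) * (m * k z + z * deriv k z) + (c - (a + b + 1) * z) * k z
    - a * b * (z * g z) with hR
  have hRc : ContinuousAt R 0 := by
    have h1 := hka.deriv.continuousAt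
    have h2 := hka.continuousAt
    have h3 := hg.continuousAt
    fun_prop
  have hR0 : ∀ᶠ z in 𝓝[≠] (0 : ℂ), R z = 0 := by
    filter_upwards [h.filter_mono nhdsWithin_le_nhds, e1.filter_mono nhdsWithin_le_nhds,
      e2.filter_mono nhdsWithin_le_nhds, hfg.filter_mono nhdsWithin_le_nhds,
      self_mem_nhdsWithin] with z hz h1 h2 h3 hz0
    have : z ^ m * R z = 0 := by
      have := hz.2.2
      rw [h1, h3] at this
      simp only [hR]
      linear_combination this - (1 - z) * h2
    exact (mul_eq_zero.1 this).resolve_left (pow_ne_zero m hz0)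
  have hR00 : R 0 = 0 := by
    have t1 : Tendsto R (𝓝[≠] 0) (𝓝 (R 0)) := hRc.tendsto.mono_left nhdsWithin_le_nhds
    have t2 : Tendsto R (𝓝[≠] 0) (𝓝 0) := tendsto_const_nhds.congr' (hR0.mono fun _ h => h.symm)
    exact tendsto_nhds_unique t1 t2
  have h5 : ((m : ℂ) + c) * (((m : ℂ) + 1) * g 0) = 0 := by
    simp [hR, hk] at hR00
    linear_combination hR00
  have h6 : (m : ℂ) + 1 ≠ 0 := by exact_mod_cast m.succ_ne_zero
  rcases mul_eq_zero.1 h5 with h7 | h7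
  · exact hc m (by linear_combination h7)
  · exact (mul_ne_zero h6 hg0) h7

/-- The continued function is holomorphic on the half-plane `Re z < 1/2`. -/
theorem differentiableOn_hypergeometricContinuation {a b c : ℂ} (hc : ∀ k : ℕ, c ≠ -k) :
    DifferentiableOn ℂ (hypergeometricContinuation a b c) {z : ℂ | z.re < 1 / 2} := by
  obtain ⟨g1, g2, H⟩ := hypergeometricContinuation_ode (a := a) (b := b) hc
  exact fun z hz => (H z hz).1.differentiableAt.differentiableWithinAt

/-- The continued function agrees with the Gauss series wherever the series converges. -/
theorem hypergeometricContinuation_eq {a b c : ℂ} (hc : ∀ k : ℕ, c ≠ -k) :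
    EqOn (hypergeometricContinuation a b c) (fun z => ordinaryHypergeometric a b c z)
      ({z : ℂ | z.re < 1 / 2} ∩ Metric.ball 0 1) := by
  obtain ⟨g1, g2, H⟩ := hypergeometricContinuation_ode (a := a) (b := b) hc
  obtain ⟨h1, h2, K⟩ := ordinaryHypergeometric_ode (a := a) (b := b) hc
  have hU : IsOpen {z : ℂ | z.re < 1 / 2} := isOpen_lt Complex.continuous_re continuous_const
  have hUB : IsOpen ({z : ℂ | z.re < 1 / 2} ∩ Metric.ball (0 : ℂ) 1) := hU.inter Metric.isOpen_ball
  have h0 : (0 : ℂ) ∈ {z : ℂ | z.re < 1 / 2} ∩ Metric.ball (0 : ℂ) 1 := by simp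
  have hA : AnalyticOnNhd ℂ (hypergeometricContinuation a b c)
      ({z : ℂ | z.re < 1 / 2} ∩ Metric.ball 0 1) :=
    ((differentiableOn_hypergeometricContinuation hc).mono inter_subset_left).analyticOnNhd hUB
  have hB : AnalyticOnNhd ℂ (fun z : ℂ => ordinaryHypergeometric a b c z)
      ({z : ℂ | z.re < 1 / 2} ∩ Metric.ball 0 1) :=
    DifferentiableOn.analyticOnNhd (fun z hz =>
      (K z (by simpa using hz.2)).1.differentiableAt.differentiableWithinAt) hUB
  refine hA.eqOn_of_preconnected_of_eventuallyEq hB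
    ((convex_halfSpace_re_lt _).inter (convex_ball _ _)).isPreconnected h0 ?_
  have := eventually_eq_zero_of_hypergeometric_ode (a := a) (b := b) hc
    (f := fun z => hypergeometricContinuation a b c z - ordinaryHypergeometric a b c z)
    (f1 := fun z => g1 z - h1 z) (f2 := fun z => g2 z - h2 z) ((hA 0 h0).sub (hB 0 h0))
    (by simp [hypergeometricContinuation]) (by
      filter_upwards [hUB.mem_nhds h0] with z hz
      obtain ⟨a1, a2, a3⟩ := H z hz.1
      obtain ⟨b1, b2, b3⟩ := K z (by simpa using hz.2)
      exact ⟨a1.sub b1, a2.sub b2, by linear_combination a3 - b3⟩)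
  exact this.mono fun z hz => sub_eq_zero.1 hz

/-- The number `ρ = α + β + 1`. -/
noncomputable def jacobiRho (α β : ℝ) : ℝ := α + β + 1

/-- The Jacobi function `φ_l^{(α,β)}(x) = ₂F₁((ρ - i l)/2, (ρ + i l)/2; α + 1; -sinh² x)`. -/
noncomputable def jacobiFunction (α β : ℝ) (l : ℂ) (x : ℝ) : ℂ :=
  hypergeometricContinuation ((jacobiRho α β - Complex.I * l) / 2)
    ((jacobiRho α β + Complex.I * l) / 2) (α + 1) (-((Real.sinh x : ℝ) : ℂ) ^ 2)

/-- The weight `A(x) = (2 sinh x)^(2α+1) (2 cosh x)^(2β+1)`, for `x > 0`. -/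
noncomputable def jacobiWeight (α β x : ℝ) : ℝ :=
  (2 * Real.sinh x) ^ (2 * α + 1) * (2 * Real.cosh x) ^ (2 * β + 1)

/-- The measure `A(x) dx` on `(0, ∞)`, viewed as a measure on `ℝ` carried by `(0, ∞)`. -/
noncomputable def jacobiMeasure (α β : ℝ) : Measure ℝ :=
  (volume.restrict (Ioi 0)).withDensity (fun x => ENNReal.ofReal (jacobiWeight α β x))

/-- The closed strip `S_p = {l : |Im l| ≤ |1 - 2/p| ρ}`. -/
def jacobiStrip (α β p : ℝ) : Set ℂ := {l : ℂ | |l.im| ≤ |1 - 2 / p| * jacobiRho α β}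

/-- The nonincreasing rearrangement
`f^*(t) = inf {s > 0 : μ {|f| > s} ≤ t}`, with `inf ∅ = ∞`. -/
noncomputable def nonincreasingRearrangement {X : Type*} [MeasurableSpace X] (f : X → ℂ)
    (μ : Measure X) (t : ℝ) : ℝ≥0∞ :=
  ⨅ (s : ℝ) (_ : 0 < s) (_ : μ {x | s < ‖f x‖} ≤ ENNReal.ofReal t), ENNReal.ofReal s

/-- The Lorentz (quasi-)norm of exponents `p, q`: for `q < ∞` it is
`((q/p) ∫_0^∞ (s^(1/p) f^*(s))^q ds/s)^(1/q)`, for `q = ∞` it is `sup_{s > 0} s^(1/p) f^*(s)`.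
It is meant for `1 ≤ p < ∞`, `1 ≤ q ≤ ∞` and for `p = q = ∞`, where it is `sup_{s > 0} f^*(s)`,
the essential supremum of `|f|`. -/
noncomputable def lorentzNorm {X : Type*} [MeasurableSpace X] (f : X → ℂ) (p q : ℝ≥0∞)
    (μ : Measure X) : ℝ≥0∞ :=
  if q = ∞ then
    ⨆ (s : ℝ) (_ : 0 < s), ENNReal.ofReal s ^ (p⁻¹).toReal * nonincreasingRearrangement f μ s
  else
    (q / p * ∫⁻ s in Ioi (0 : ℝ),
      (ENNReal.ofReal s ^ (p⁻¹).toReal * nonincreasingRearrangement f μ s) ^ q.toReal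
        / ENNReal.ofReal s) ^ (q⁻¹).toReal

/-- Membership in the Lorentz space `L^{p,q}(μ)`. -/
def MemLorentz {X : Type*} [MeasurableSpace X] (f : X → ℂ) (p q : ℝ≥0∞) (μ : Measure X) : Prop :=
  Measurable f ∧ lorentzNorm f p q μ < ∞

/-!
The exponents in the theorem come from matching two exponential rates. The volume `μ (0, X)` is at
most a multiple of `exp (2 ρ X)` (`jacobiMeasure_Iio_le`), so a function that is
`O(exp (-2 ρ θ x))` has rearrangement `O(t ^ (-θ))` (`nonincreasingRearrangement_le_of_exp_decay`).
For `θ = 1 / r` this is weak type `r`, and decay strictly faster than `t ^ (-1 / r)`, together with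
boundedness, puts a function in `L^{r, q}` for every finite `q` (`lorentzNorm_lt_top`).

It remains to see that `φ_l` decays like `exp ((|Im l| - ρ) x)`, with an additional factor `1 + x`
when `l` is real. No connection formula is needed. In the form of Pfaff's transformation, which
defines the continuation, `φ_l(x)` is `(cosh x) ^ (-(ρ - i l))` times a Gauss series at `tanh² x`
(`norm_jacobiFunction`). The excess of the upper over the lower parameters of this series has real
part `Im l`, so by Euler's limit formula for the Gamma function its coefficients are
`O(n ^ (Im l - 1))` (`isBigO_ordinaryHypergeometricCoefficient`). If `Im l < 0` they are absolutely
summable and the series is bounded on `[0, 1)`. If `Im l = 0` the series is dominated by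
`1 - C log (1 - tanh² x) = 1 + 2 C log (cosh x)`, which is `O(1 + x)`. The case `Im l > 0` reduces to
`Im l < 0`, because `φ_l = φ_{-l}`: the upper parameters of `₂F₁` may be exchanged
(`hypergeometricContinuation_symm`).

On the boundary of `S_p`, with `p < 2`, one has `ρ - |Im l| = 2 ρ / p'`, and in the interior
`ρ - |Im l|` is larger; on the line `Im l = 0` an arbitrarily small loss of exponent absorbs the
factor `1 + x` (`norm_jacobiFunction_le`).
-/

/-! ### Growth of the coefficients of the Gauss series -/

theorem ascPochhammer_eval_eq_prod (s : ℂ) (n : ℕ) :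
    (ascPochhammer ℂ n).eval s = ∏ j ∈ Finset.range n, (s + j) := by
  induction n with
  | zero => simp
  | succ n ih => rw [ascPochhammer_succ_eval, ih, Finset.prod_range_succ]

theorem isBigO_ascPochhammer_eval (s : ℂ) :
    (fun n : ℕ => (ascPochhammer ℂ (n + 1)).eval s) =O[atTop]
      fun n : ℕ => (n : ℂ) ^ s * n.factorial := by
  by_cases hs : ∃ k : ℕ, s = -k
  · obtain ⟨k, rfl⟩ := hs
    refine EventuallyEq.trans_isBigO (f₂ := fun _ => (0 : ℂ)) ?_ (Asymptotics.isBigO_zero _ _)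
    filter_upwards [eventually_ge_atTop k] with n hn
    exact (ascPochhammer_eval_eq_zero_iff _ _).2 ⟨k, by omega, by simp⟩
  · push Not at hs
    have h1 := (Complex.GammaSeq_tendsto_Gamma s).inv₀ (Complex.Gamma_ne_zero hs)
    have h2 := (h1.isBigO_one ℝ).mul
      (Asymptotics.isBigO_refl (fun n : ℕ => (n : ℂ) ^ s * n.factorial) atTop).norm_right
    simp only [one_mul] at h2
    refine (EventuallyEq.trans_isBigO ?_ h2).of_norm_right
    filter_upwards [eventually_ne_atTop 0] with n hn
    have h3 : ((n : ℂ) ^ s * n.factorial) ≠ 0 := mul_ne_zero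
      (by rw [Complex.cpow_ne_zero_iff]; left; exact_mod_cast hn)
      (by exact_mod_cast n.factorial_ne_zero)
    rw [Complex.GammaSeq, ascPochhammer_eval_eq_prod, inv_div, div_mul_cancel₀ _ h3]

/-- At a nonpositive integer `c` the left side is eventually zero, by the convention `0⁻¹ = 0`. -/
theorem isBigO_inv_ascPochhammer_eval (c : ℂ) :
    (fun n : ℕ => ((ascPochhammer ℂ (n + 1)).eval c)⁻¹) =O[atTop]
      fun n : ℕ => ((n : ℂ) ^ c * n.factorial)⁻¹ := by
  have h2 := ((Complex.GammaSeq_tendsto_Gamma c).isBigO_one ℝ).mul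
    (Asymptotics.isBigO_refl (fun n : ℕ => ((n : ℂ) ^ c * n.factorial)⁻¹) atTop).norm_right
  simp only [one_mul] at h2
  refine (EventuallyEq.trans_isBigO ?_ h2).of_norm_right
  filter_upwards [eventually_ne_atTop 0] with n hn
  have h3 : ((n : ℂ) ^ c * n.factorial) ≠ 0 := mul_ne_zero
    (by rw [Complex.cpow_ne_zero_iff]; left; exact_mod_cast hn)
    (by exact_mod_cast n.factorial_ne_zero)
  rw [Complex.GammaSeq, ascPochhammer_eval_eq_prod, div_mul_eq_mul_div, mul_inv_cancel₀ h3, one_div]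

/-- The coefficients of the Gauss series satisfy `uₙ₊₁ = O(n ^ Re (a + b - c) / (n + 1))`, by Euler's
limit formula for the Gamma function. -/
theorem isBigO_ordinaryHypergeometricCoefficient (a b c : ℂ) :
    (fun n : ℕ => ordinaryHypergeometricCoefficient a b c (n + 1)) =O[atTop]
      fun n : ℕ => (n : ℝ) ^ (a + b - c).re / ((n : ℝ) + 1) := by
  have h := ((isBigO_ascPochhammer_eval a).mul (isBigO_ascPochhammer_eval b)).mul
    (isBigO_inv_ascPochhammer_eval c)
  have h' := h.mul (Asymptotics.isBigO_refl
    (fun n : ℕ => (((n + 1).factorial : ℕ) : ℂ)⁻¹) atTop)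
  refine (h'.congr_left fun n => ?_).trans (EventuallyEq.isBigO ?_).of_norm_left
  · simp only [ordinaryHypergeometricCoefficient]; ring
  · filter_upwards [eventually_gt_atTop 0] with n hn
    have hn' : (0 : ℝ) < n := by exact_mod_cast hn
    have hfac : (n.factorial : ℝ) ≠ 0 := by exact_mod_cast n.factorial_ne_zero
    have hnp : ∀ s : ℂ, ‖(n : ℂ) ^ s‖ = (n : ℝ) ^ s.re := fun s =>
      Complex.norm_natCast_cpow_of_pos hn s
    simp only [norm_mul, norm_inv, hnp, Complex.norm_natCast, Nat.factorial_succ]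
    rw [Complex.sub_re, Complex.add_re, Real.rpow_sub hn', Real.rpow_add hn']
    have : (n : ℝ) ^ c.re ≠ 0 := (Real.rpow_pos_of_pos hn' _).ne'
    push_cast
    field_simp

/-! ### The Gauss series on `[0, 1)` -/

theorem ordinaryHypergeometric_eq_tsum_coefficient (a b c w : ℂ) :
    ordinaryHypergeometric a b c w
      = ∑' n : ℕ, ordinaryHypergeometricCoefficient a b c n * w ^ n := by
  rw [ordinaryHypergeometric_eq_tsum]; rfl

theorem ordinaryHypergeometric_bounded {a b c : ℂ} (h : (a + b - c).re < 0) :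
    ∃ C : ℝ, ∀ w : ℝ, 0 ≤ w → w < 1 → ‖ordinaryHypergeometric a b c (w : ℂ)‖ ≤ C := by
  set u := ordinaryHypergeometricCoefficient a b c with hu
  have hs : Summable fun n => ‖u n‖ := by
    rw [← summable_nat_add_iff 1]
    refine summable_of_isBigO_nat (Real.summable_nat_rpow.2 (show (a + b - c).re - 1 < -1 by linarith))
      ((isBigO_ordinaryHypergeometricCoefficient a b c).norm_left.trans ?_)
    refine Asymptotics.IsBigO.of_bound 1 ?_
    filter_upwards [eventually_gt_atTop 0] with n hn
    have hn' : (0 : ℝ) < n := by exact_mod_cast hn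
    rw [Real.rpow_sub_one hn'.ne', one_mul, Real.norm_of_nonneg (by positivity),
      Real.norm_of_nonneg (by positivity)]
    gcongr
    linarith
  refine ⟨∑' n, ‖u n‖, fun w h0 h1 => ?_⟩
  rw [ordinaryHypergeometric_eq_tsum_coefficient]
  refine tsum_of_norm_bounded hs.hasSum fun n => ?_
  rw [norm_mul, norm_pow, Complex.norm_real, Real.norm_of_nonneg h0]
  exact mul_le_of_le_one_right (norm_nonneg _) (pow_le_one₀ h0 h1.le)

theorem ordinaryHypergeometric_log_bound {a b c : ℂ} (h : (a + b - c).re = 0) :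
    ∃ C : ℝ, 0 ≤ C ∧ ∀ w : ℝ, 0 ≤ w → w < 1 →
      ‖ordinaryHypergeometric a b c (w : ℂ)‖ ≤ 1 + C * -Real.log (1 - w) := by
  have hO := isBigO_ordinaryHypergeometricCoefficient a b c
  simp only [h, Real.rpow_zero] at hO
  obtain ⟨C, hC0, hC⟩ := Asymptotics.bound_of_isBigO_nat_atTop hO
  refine ⟨C, hC0.le, fun w h0 h1 => ?_⟩
  have hlog := (Real.hasSum_pow_div_log_of_abs_lt_one (by rwa [abs_of_nonneg h0])).mul_left C
  set v : ℕ → ℝ := fun n => if n = 0 then 1 else C * (w ^ n / n) with hv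
  have hvs : HasSum v (1 + C * -Real.log (1 - w)) := by
    rw [← hasSum_nat_add_iff' 1]
    simpa [hv] using hlog
  rw [ordinaryHypergeometric_eq_tsum_coefficient]
  refine tsum_of_norm_bounded hvs fun n => ?_
  rw [norm_mul, norm_pow, Complex.norm_real, Real.norm_of_nonneg h0]
  rcases n with _ | n
  · simp [hv, ordinaryHypergeometricCoefficient]
  · have hn : (0 : ℝ) < (n : ℝ) + 1 := by positivity
    have := hC (x := n) (by positivity)
    rw [Real.norm_of_nonneg (by positivity)] at this
    simp only [hv, Nat.add_eq_zero_iff, one_ne_zero, and_false, if_false]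
    calc _ ≤ C * (1 / ((n : ℝ) + 1)) * w ^ (n + 1) := by gcongr
      _ = _ := by push_cast; ring

/-! ### Estimates for Jacobi functions -/

/-- The continued hypergeometric function is symmetric in its two upper parameters, although the
formula that defines it is not. -/
theorem hypergeometricContinuation_symm {a b c z : ℂ} (hc : ∀ k : ℕ, c ≠ -k) (hz : z.re < 1 / 2) :
    hypergeometricContinuation a b c z = hypergeometricContinuation b a c z := by
  have hU : IsOpen {z : ℂ | z.re < 1 / 2} := isOpen_lt Complex.continuous_re continuous_const
  refine ((differentiableOn_hypergeometricContinuation hc).analyticOnNhd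
    hU).eqOn_of_preconnected_of_eventuallyEq
    ((differentiableOn_hypergeometricContinuation hc).analyticOnNhd hU)
    (convex_halfSpace_re_lt _).isPreconnected (z₀ := 0) (by simp) ?_ hz
  filter_upwards [(hU.inter Metric.isOpen_ball).mem_nhds
    (show (0 : ℂ) ∈ {z : ℂ | z.re < 1 / 2} ∩ Metric.ball 0 1 by simp)] with w hw
  rw [hypergeometricContinuation_eq hc hw, hypergeometricContinuation_eq hc hw]
  simp only [ordinaryHypergeometric, ordinaryHypergeometricSeries_symm]

theorem ofReal_add_one_ne_neg_natCast {α : ℝ} (hα : -(1 / 2) < α) (k : ℕ) :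
    (α : ℂ) + 1 ≠ -k := by
  intro h
  have := congrArg Complex.re h
  simp at this
  have : (0 : ℝ) ≤ k := k.cast_nonneg
  linarith

theorem neg_sinh_sq_re_lt (x : ℝ) : (-((Real.sinh x : ℝ) : ℂ) ^ 2).re < 1 / 2 := by
  rw [← Complex.ofReal_pow, ← Complex.ofReal_neg, Complex.ofReal_re]
  nlinarith [sq_nonneg (Real.sinh x)]

theorem jacobiFunction_neg {α β : ℝ} (hα : -(1 / 2) < α) (l : ℂ) (x : ℝ) :
    jacobiFunction α β (-l) x = jacobiFunction α β l x := by
  rw [jacobiFunction, jacobiFunction, hypergeometricContinuation_symm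
    (ofReal_add_one_ne_neg_natCast hα) (neg_sinh_sq_re_lt x)]
  simp only [mul_neg, sub_neg_eq_add, ← sub_eq_add_neg]

theorem continuous_jacobiFunction {α β : ℝ} (hα : -(1 / 2) < α) (l : ℂ) :
    Continuous (jacobiFunction α β l) := by
  have h := (differentiableOn_hypergeometricContinuation
    (a := (jacobiRho α β - Complex.I * l) / 2) (b := (jacobiRho α β + Complex.I * l) / 2)
    (ofReal_add_one_ne_neg_natCast hα)).continuousOn
  refine h.comp_continuous (f := fun x : ℝ => -((Real.sinh x : ℝ) : ℂ) ^ 2) ?_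
    fun x => neg_sinh_sq_re_lt x
  have := Real.continuous_sinh
  fun_prop

/-- The norm of a Jacobi function through a Gauss series at the point `tanh² x` of `[0, 1)`. -/
theorem norm_jacobiFunction (α β : ℝ) (l : ℂ) (x : ℝ) :
    ‖jacobiFunction α β l x‖ = (Real.cosh x ^ 2) ^ (-((jacobiRho α β + l.im) / 2)) *
      ‖ordinaryHypergeometric ((jacobiRho α β - Complex.I * l) / 2)
        ((α : ℂ) + 1 - (jacobiRho α β + Complex.I * l) / 2) ((α : ℂ) + 1)
        ((1 - (Real.cosh x ^ 2)⁻¹ : ℝ) : ℂ)‖ := by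
  have hcosh : 0 < Real.cosh x := Real.cosh_pos x
  have h1 : 1 - -((Real.sinh x : ℝ) : ℂ) ^ 2 = ((Real.cosh x ^ 2 : ℝ) : ℂ) := by
    rw [Real.cosh_sq]; push_cast; ring
  have h2 : -((Real.sinh x : ℝ) : ℂ) ^ 2 / (-((Real.sinh x : ℝ) : ℂ) ^ 2 - 1)
      = ((1 - (Real.cosh x ^ 2)⁻¹ : ℝ) : ℂ) := by
    have h3 : -((Real.sinh x : ℝ) : ℂ) ^ 2 - 1 = -((Real.cosh x ^ 2 : ℝ) : ℂ) := by
      rw [← h1]; ring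
    have h4 : -((Real.sinh x : ℝ) : ℂ) ^ 2 = 1 - ((Real.cosh x ^ 2 : ℝ) : ℂ) := by
      rw [← h1]; ring
    have h5 : ((Real.cosh x ^ 2 : ℝ) : ℂ) ≠ 0 := by
      exact_mod_cast (pow_pos hcosh 2).ne'
    rw [h3, h4, Complex.ofReal_sub, Complex.ofReal_inv]
    field_simp
    push_cast
    ring
  rw [jacobiFunction, hypergeometricContinuation, h1, h2, norm_mul,
    Complex.norm_cpow_eq_rpow_re_of_pos (by positivity)]
  congr 2
  simp

theorem cosh_sq_rpow_le {κ x : ℝ} (hκ : 0 ≤ κ) :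
    (Real.cosh x ^ 2) ^ (-(κ / 2)) ≤ 2 ^ κ * Real.exp (-(κ * x)) := by
  have h1 : Real.exp x / 2 ≤ Real.cosh x := by
    rw [Real.cosh_eq]; linarith [Real.exp_pos (-x)]
  have h2 : 0 < Real.exp x := Real.exp_pos x
  rw [← Real.rpow_natCast, ← Real.rpow_mul (Real.cosh_pos x).le]
  refine (Real.rpow_le_rpow_of_nonpos (by positivity) h1 (by push_cast; linarith)).trans_eq ?_
  rw [show ((2 : ℕ) : ℝ) * -(κ / 2) = -κ by push_cast; ring, Real.div_rpow h2.le zero_le_two,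
    ← Real.exp_mul, Real.rpow_neg zero_le_two, div_inv_eq_mul]
  ring_nf

theorem one_sub_inv_cosh_sq_mem (x : ℝ) :
    0 ≤ 1 - (Real.cosh x ^ 2)⁻¹ ∧ 1 - (Real.cosh x ^ 2)⁻¹ < 1 := by
  have h1 : 1 ≤ Real.cosh x ^ 2 := one_le_pow₀ (Real.one_le_cosh x)
  exact ⟨sub_nonneg.2 (inv_le_one_of_one_le₀ h1), sub_lt_self _ (by positivity)⟩

/-- The excess `a + b - c` of the upper over the lower parameters, for the Gauss series of
`norm_jacobiFunction`. -/
theorem re_excess_jacobi (ρ α : ℝ) (l : ℂ) :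
    ((ρ - Complex.I * l) / 2 + ((α : ℂ) + 1 - (ρ + Complex.I * l) / 2) - ((α : ℂ) + 1)).re
      = l.im := by
  rw [show (ρ - Complex.I * l) / 2 + ((α : ℂ) + 1 - (ρ + Complex.I * l) / 2) - ((α : ℂ) + 1)
    = -(Complex.I * l) by ring]
  simp

theorem norm_jacobiFunction_le_of_im_neg {α β : ℝ} {l : ℂ} (hl : l.im < 0)
    (hlρ : 0 ≤ jacobiRho α β + l.im) :
    ∃ C : ℝ, ∀ x : ℝ,
      ‖jacobiFunction α β l x‖ ≤ C * Real.exp (-((jacobiRho α β + l.im) * x)) := by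
  obtain ⟨C, hC⟩ := ordinaryHypergeometric_bounded
    ((re_excess_jacobi (jacobiRho α β) α l).trans_lt hl)
  refine ⟨2 ^ (jacobiRho α β + l.im) * C, fun x => ?_⟩
  obtain ⟨h0, h1⟩ := one_sub_inv_cosh_sq_mem x
  rw [norm_jacobiFunction]
  refine (mul_le_mul (cosh_sq_rpow_le hlρ) (hC _ h0 h1) (norm_nonneg _)
    (by positivity)).trans_eq (by ring)

theorem norm_jacobiFunction_le_of_im_eq_zero {α β : ℝ} (hρ : 0 ≤ jacobiRho α β) {l : ℂ} (hl : l.im = 0) :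
    ∃ C : ℝ, ∀ x : ℝ, 0 ≤ x →
      ‖jacobiFunction α β l x‖ ≤ C * (1 + x) * Real.exp (-(jacobiRho α β * x)) := by
  obtain ⟨C, hC0, hC⟩ := ordinaryHypergeometric_log_bound
    ((re_excess_jacobi (jacobiRho α β) α l).trans hl)
  refine ⟨2 ^ jacobiRho α β * (1 + 2 * C), fun x hx => ?_⟩
  obtain ⟨h0, h1⟩ := one_sub_inv_cosh_sq_mem x
  rw [norm_jacobiFunction, hl, add_zero]
  have hlog : Real.log (Real.cosh x) ≤ x := by
    rw [Real.log_le_iff_le_exp (Real.cosh_pos x), Real.cosh_eq]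
    have : Real.exp (-x) ≤ Real.exp x := Real.exp_le_exp.2 (by linarith)
    linarith
  have h2 := hC _ h0 h1
  rw [sub_sub_cancel, Real.log_inv, neg_neg, Real.log_pow] at h2
  have h3 : 1 + C * ((2 : ℕ) * Real.log (Real.cosh x)) ≤ (1 + 2 * C) * (1 + x) := by
    push_cast
    nlinarith [mul_le_mul_of_nonneg_left hlog hC0]
  refine (mul_le_mul (cosh_sq_rpow_le hρ) (h2.trans h3) (norm_nonneg _)
    (by positivity)).trans_eq (by ring)

/-- A Jacobi function decays like `exp (-(ρ - σ) x)` for every `σ > 0` with `|Im l| ≤ σ ≤ ρ`. The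
value `σ = 0` is excluded because of the factor `1 + x` that comes in for real `l`. -/
theorem norm_jacobiFunction_le {α β : ℝ} (hα : -(1 / 2) < α) {l : ℂ} {σ : ℝ} (hσ : 0 < σ)
    (hl : |l.im| ≤ σ) (hσρ : σ ≤ jacobiRho α β) :
    ∃ C : ℝ, ∀ x : ℝ, 0 < x →
      ‖jacobiFunction α β l x‖ ≤ C * Real.exp (-((jacobiRho α β - σ) * x)) := by
  have key : ∀ {l : ℂ}, |l.im| ≤ σ → l.im < 0 → ∃ C : ℝ, ∀ x : ℝ, 0 < x →
      ‖jacobiFunction α β l x‖ ≤ C * Real.exp (-((jacobiRho α β - σ) * x)) := by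
    intro l hl hneg
    rw [abs_of_neg hneg] at hl
    obtain ⟨C, hC⟩ := norm_jacobiFunction_le_of_im_neg hneg
      (show 0 ≤ jacobiRho α β + l.im by linarith)
    have hC0 : 0 ≤ C := by simpa using (norm_nonneg _).trans (hC 0)
    refine ⟨C, fun x hx => (hC x).trans ?_⟩
    gcongr
    linarith
  rcases lt_trichotomy l.im 0 with hneg | h0 | hpos
  · exact key hl hneg
  · obtain ⟨C, hC⟩ := norm_jacobiFunction_le_of_im_eq_zero (hσ.le.trans hσρ) h0
    have hC0 : 0 ≤ C := by simpa using (norm_nonneg _).trans (hC 0 le_rfl)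
    refine ⟨C * (1 + σ⁻¹), fun x hx => (hC x hx.le).trans ?_⟩
    have h1 : 1 + x ≤ (1 + σ⁻¹) * Real.exp (σ * x) := by
      have h2 : σ * x + 1 ≤ Real.exp (σ * x) := Real.add_one_le_exp _
      calc 1 + x ≤ (1 + σ⁻¹) * (σ * x + 1) := by
            have : (1 + σ⁻¹) * (σ * x + 1) = 1 + x + (σ * x + σ⁻¹) := by field_simp; ring
            rw [this]
            have : 0 ≤ σ * x + σ⁻¹ := by positivity
            linarith
        _ ≤ _ := by gcongr
    calc C * (1 + x) * Real.exp (-(jacobiRho α β * x))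
        ≤ C * ((1 + σ⁻¹) * Real.exp (σ * x)) * Real.exp (-(jacobiRho α β * x)) := by gcongr
      _ = C * (1 + σ⁻¹) * (Real.exp (σ * x) * Real.exp (-(jacobiRho α β * x))) := by ring
      _ = _ := by rw [← Real.exp_add]; ring_nf
  · obtain ⟨C, hC⟩ := key (l := -l) (by simpa using hl) (by simpa using hpos)
    exact ⟨C, fun x hx => by simpa only [jacobiFunction_neg hα] using hC x hx⟩

/-! ### Lorentz norms and decay of the rearrangement -/

section Lorentz

variable {X : Type*} [MeasurableSpace X] {f : X → ℂ} {μ : Measure X} {p : ℝ≥0∞}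

theorem lorentzNorm_top_lt_top {K : ℝ}
    (h : ∀ t : ℝ, 0 < t →
      nonincreasingRearrangement f μ t ≤ ENNReal.ofReal (K * t ^ (-(p⁻¹).toReal))) :
    lorentzNorm f p ⊤ μ < ⊤ := by
  rw [lorentzNorm, if_pos rfl]
  refine lt_of_le_of_lt (iSup₂_le fun s hs => ?_) (ENNReal.ofReal_lt_top (r := K))
  refine (mul_le_mul_right (h s hs) _).trans_eq ?_
  rw [ENNReal.ofReal_rpow_of_pos hs, ← ENNReal.ofReal_mul (by positivity), mul_left_comm,
    ← Real.rpow_add hs, add_neg_cancel, Real.rpow_zero, mul_one]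

theorem lorentz_integrand_le {K θ τ r s : ℝ} (hK : 0 ≤ K) (hr : 0 ≤ r) (hs : 0 < s) {y : ℝ≥0∞}
    (hy : y ≤ ENNReal.ofReal (K * s ^ (-θ))) :
    (ENNReal.ofReal s ^ τ * y) ^ r / ENNReal.ofReal s
      ≤ ENNReal.ofReal (K ^ r * s ^ ((τ - θ) * r - 1)) := by
  have h1 : ENNReal.ofReal s ^ τ * y ≤ ENNReal.ofReal (K * s ^ (τ - θ)) := by
    refine (mul_le_mul_right hy _).trans_eq ?_
    rw [ENNReal.ofReal_rpow_of_pos hs, ← ENNReal.ofReal_mul (by positivity), mul_left_comm,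
      ← Real.rpow_add hs, sub_eq_add_neg]
  refine (ENNReal.div_le_div_right (ENNReal.rpow_le_rpow h1 hr) _).trans_eq ?_
  rw [ENNReal.ofReal_rpow_of_nonneg (by positivity) hr, ← ENNReal.ofReal_div_of_pos hs,
    Real.mul_rpow hK (by positivity), ← Real.rpow_mul hs.le, Real.rpow_sub_one hs.ne', mul_div_assoc]

/-- If `f^*` is bounded and `f^*(t) = O(t ^ (-θ))` with `θ > 1 / p`, then the integral that defines
the Lorentz norm of exponents `p, q` converges at `0` and at `∞`. -/
theorem lorentzNorm_lt_top {K₀ K θ : ℝ} (hK₀ : 0 ≤ K₀) (hK : 0 ≤ K) {q : ℝ≥0∞} (hq : 1 ≤ q)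
    (hq' : q ≠ ⊤) (hp : 0 < (p⁻¹).toReal) (hθ : (p⁻¹).toReal < θ)
    (h0 : ∀ t : ℝ, 0 < t → nonincreasingRearrangement f μ t ≤ ENNReal.ofReal K₀)
    (h : ∀ t : ℝ, 0 < t → nonincreasingRearrangement f μ t ≤ ENNReal.ofReal (K * t ^ (-θ))) :
    lorentzNorm f p q μ < ⊤ := by
  have hr : 0 < q.toReal := ENNReal.toReal_pos (zero_lt_one.trans_le hq).ne' hq'
  have hp0 : p ≠ 0 := by rintro rfl; simp at hp
  rw [lorentzNorm, if_neg hq']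
  refine ENNReal.rpow_lt_top_of_nonneg ENNReal.toReal_nonneg
    (ENNReal.mul_ne_top (ENNReal.div_ne_top hq' hp0) ?_)
  rw [← Ioc_union_Ioi_eq_Ioi (zero_le_one (α := ℝ))]
  refine ((lintegral_union_le _ _ _).trans_lt (ENNReal.add_lt_top.2 ⟨?_, ?_⟩)).ne
  · have hi : IntegrableOn (fun s : ℝ => K₀ ^ q.toReal * s ^ (((p⁻¹).toReal - 0) * q.toReal - 1))
        (Ioc 0 1) :=
      ((intervalIntegrable_iff_integrableOn_Ioc_of_le zero_le_one).1
        (intervalIntegral.intervalIntegrable_rpow' (by nlinarith [mul_pos hp hr]))).const_mul _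
    refine lt_of_le_of_lt (setLIntegral_mono' measurableSet_Ioc fun s hs => ?_) hi.lintegral_lt_top
    exact lorentz_integrand_le hK₀ hr.le hs.1 (by simpa using h0 s hs.1)
  · have hi : IntegrableOn (fun s : ℝ => K ^ q.toReal * s ^ (((p⁻¹).toReal - θ) * q.toReal - 1))
        (Ioi 1) :=
      (integrableOn_Ioi_rpow_of_lt (by nlinarith [mul_pos (sub_pos.2 hθ) hr])
        zero_lt_one).const_mul _
    refine lt_of_le_of_lt (setLIntegral_mono' measurableSet_Ioi fun s hs => ?_) hi.lintegral_lt_top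
    exact lorentz_integrand_le hK hr.le (zero_lt_one.trans hs) (h s (zero_lt_one.trans hs))

end Lorentz

theorem toReal_inv_conjExponent {p : ℝ} (hp : 1 ≤ p) :
    ((ENNReal.conjExponent (ENNReal.ofReal p))⁻¹).toReal = 1 - 1 / p := by
  have hp0 : 0 < p := zero_lt_one.trans_le hp
  have h := (ENNReal.HolderConjugate.conjExponent
    (show 1 ≤ ENNReal.ofReal p by simpa using hp)).inv_add_inv_eq_one
  have h1 : (ENNReal.ofReal p)⁻¹ ≠ ⊤ := by simpa using hp0
  have h2 : (ENNReal.conjExponent (ENNReal.ofReal p))⁻¹ ≠ ⊤ :=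
    ne_top_of_le_ne_top ENNReal.one_ne_top (h ▸ le_add_self)
  have h3 := congrArg ENNReal.toReal h
  rw [ENNReal.toReal_add h1 h2, ENNReal.toReal_inv, ENNReal.toReal_ofReal hp0.le,
    ENNReal.toReal_one] at h3
  rw [one_div]
  linarith

/-! ### The Jacobi measure -/

theorem jacobiWeight_le {α β x : ℝ} (hα : -(1 / 2) < α) (hβ : -(1 / 2) ≤ β) (hx : 0 < x) :
    jacobiWeight α β x ≤ 2 ^ (2 * β + 1) * Real.exp (2 * jacobiRho α β * x) := by
  have he : Real.exp (-x) ≤ Real.exp x := Real.exp_le_exp.2 (by linarith)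
  have h1 : 2 * Real.sinh x ≤ Real.exp x := by
    rw [Real.sinh_eq]; linarith [Real.exp_pos (-x)]
  have h2 : 2 * Real.cosh x ≤ 2 * Real.exp x := by
    rw [Real.cosh_eq]; linarith
  have h3 : 0 < Real.sinh x := Real.sinh_pos_iff.2 hx
  have h4 : 0 < Real.cosh x := Real.cosh_pos x
  calc jacobiWeight α β x
      ≤ Real.exp x ^ (2 * α + 1) * (2 * Real.exp x) ^ (2 * β + 1) := by
        refine mul_le_mul (Real.rpow_le_rpow (by positivity) h1 (by linarith))
          (Real.rpow_le_rpow (by positivity) h2 (by linarith)) (by positivity) (by positivity)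
    _ = 2 ^ (2 * β + 1) * (Real.exp (x * (2 * α + 1)) * Real.exp (x * (2 * β + 1))) := by
        rw [Real.mul_rpow zero_le_two (Real.exp_pos x).le, ← Real.exp_mul, ← Real.exp_mul]; ring
    _ = _ := by
        rw [← Real.exp_add, jacobiRho]; ring_nf

/-- Exponential volume growth, for every real `X`: the measure of `(0, X)` is at most a multiple of
`exp (2 ρ X)`. -/
theorem jacobiMeasure_Iio_le {α β : ℝ} (hα : -(1 / 2) < α) (hβ : -(1 / 2) ≤ β) :
    ∃ D : ℝ, 0 < D ∧ ∀ X : ℝ,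
      jacobiMeasure α β (Iio X) ≤ ENNReal.ofReal (D * Real.exp (2 * jacobiRho α β * X)) := by
  have hρ : 0 < 2 * jacobiRho α β := by rw [jacobiRho]; linarith
  refine ⟨2 ^ (2 * β + 1) / (2 * jacobiRho α β), by positivity, fun X => ?_⟩
  have hi := (integrableOn_exp_mul_Iic hρ X).const_mul (2 ^ (2 * β + 1))
  rw [jacobiMeasure, withDensity_apply _ measurableSet_Iio,
    Measure.restrict_restrict measurableSet_Iio]
  calc ∫⁻ x in Iio X ∩ Ioi 0, ENNReal.ofReal (jacobiWeight α β x)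
      ≤ ∫⁻ x in Iio X ∩ Ioi 0,
          ENNReal.ofReal (2 ^ (2 * β + 1) * Real.exp (2 * jacobiRho α β * x)) :=
        setLIntegral_mono' (measurableSet_Iio.inter measurableSet_Ioi) fun x hx =>
          ENNReal.ofReal_le_ofReal (jacobiWeight_le hα hβ hx.2)
    _ ≤ ∫⁻ x in Iic X, ENNReal.ofReal (2 ^ (2 * β + 1) * Real.exp (2 * jacobiRho α β * x)) :=
        lintegral_mono_set (inter_subset_left.trans Iio_subset_Iic_self)
    _ = _ := by
        rw [← ofReal_integral_eq_lintegral_ofReal hi (ae_of_all _ fun x => by positivity),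
          integral_const_mul, integral_exp_mul_Iic hρ]
        congr 1
        ring

theorem jacobiMeasure_Iic_zero (α β : ℝ) : jacobiMeasure α β (Iic 0) = 0 := by
  rw [jacobiMeasure, withDensity_apply _ measurableSet_Iic,
    Measure.restrict_restrict measurableSet_Iic, Iic_inter_Ioi, Ioc_self]
  simp

/-- Exponential decay `exp (-2 ρ θ x)` of a function becomes decay `t ^ (-θ)` of its rearrangement,
in view of the volume growth `exp (2 ρ X)`. -/
theorem nonincreasingRearrangement_le_of_exp_decay {α β : ℝ} (hα : -(1 / 2) < α)
    (hβ : -(1 / 2) ≤ β) {f : ℝ → ℂ} {C θ : ℝ} (hθ : 0 ≤ θ)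
    (hf : ∀ x : ℝ, 0 < x → ‖f x‖ ≤ C * Real.exp (-(2 * jacobiRho α β * θ * x))) :
    ∃ K : ℝ, 0 < K ∧ ∀ t : ℝ, 0 < t →
      nonincreasingRearrangement f (jacobiMeasure α β) t ≤ ENNReal.ofReal (K * t ^ (-θ)) := by
  obtain ⟨D, hD, hμ⟩ := jacobiMeasure_Iio_le hα hβ
  have hρ : 0 < 2 * jacobiRho α β := by rw [jacobiRho]; linarith
  have hC' : 0 < max C 1 := lt_max_of_lt_right one_pos
  refine ⟨max C 1 * D ^ θ, by positivity, fun t ht => ?_⟩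
  have hs : 0 < max C 1 * D ^ θ * t ^ (-θ) := by positivity
  refine iInf₂_le_of_le _ hs (iInf_le_of_le ?_ le_rfl)
  -- The radius at which the volume bound equals `t`; it is negative for small `t`.
  set X : ℝ := Real.log (t / D) / (2 * jacobiRho α β) with hX
  have hX1 : 2 * jacobiRho α β * X = Real.log (t / D) := by
    rw [hX, mul_div_cancel₀ _ hρ.ne']
  have hX2 : D * Real.exp (2 * jacobiRho α β * X) = t := by
    rw [hX1, Real.exp_log (by positivity)]; field_simp
  have hsX : max C 1 * D ^ θ * t ^ (-θ)
      = max C 1 * Real.exp (-(2 * jacobiRho α β * θ * X)) := by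
    rw [show -(2 * jacobiRho α β * θ * X) = 2 * jacobiRho α β * X * -θ by ring, hX1, Real.exp_mul,
      Real.exp_log (by positivity), Real.div_rpow ht.le hD.le, Real.rpow_neg hD.le]
    field_simp
  have hsub : {x | max C 1 * D ^ θ * t ^ (-θ) < ‖f x‖} ⊆ Iic 0 ∪ Iio X := by
    intro x hx
    rcases le_or_gt x 0 with h | h
    · exact Or.inl h
    right
    by_contra hxX
    have hxX : X ≤ x := not_lt.1 hxX
    refine (not_le.2 (show max C 1 * D ^ θ * t ^ (-θ) < ‖f x‖ from hx)) ?_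
    rw [hsX]
    refine (hf x h).trans (mul_le_mul (le_max_left _ _) ?_ (Real.exp_pos _).le hC'.le)
    exact Real.exp_le_exp.2 (neg_le_neg (mul_le_mul_of_nonneg_left hxX (by positivity)))
  refine (measure_mono hsub).trans ((measure_union_le _ _).trans ?_)
  rw [jacobiMeasure_Iic_zero, zero_add, ← hX2]
  exact hμ X

/-! ### Membership in Lorentz spaces -/

theorem interior_jacobiStrip_subset (α β p : ℝ) :
    interior (jacobiStrip α β p) ⊆ {l : ℂ | |l.im| < |1 - 2 / p| * jacobiRho α β} := by
  have h : jacobiStrip α β p = Complex.im ⁻¹'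
      Icc (-(|1 - 2 / p| * jacobiRho α β)) (|1 - 2 / p| * jacobiRho α β) := by
    ext l; exact abs_le (a := l.im)
  rw [h, Complex.interior_preimage_im, interior_Icc]
  exact fun l hl => abs_lt.2 hl

theorem frontier_jacobiStrip_subset (α β p : ℝ) :
    frontier (jacobiStrip α β p) ⊆ jacobiStrip α β p :=
  (isClosed_le (by fun_prop) continuous_const).frontier_subset

theorem abs_one_sub_two_div {p : ℝ} (hp : 1 ≤ p) (hp2 : p < 2) :
    |1 - 2 / p| = 2 / p - 1 ∧ 0 < 2 / p - 1 ∧ 2 / p - 1 ≤ 1 := by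
  have hp0 : 0 < p := zero_lt_one.trans_le hp
  have h1 : 1 < 2 / p := by rwa [lt_div_iff₀ hp0, one_mul]
  have h2 : 2 / p ≤ 2 := by rw [div_le_iff₀ hp0]; linarith
  exact ⟨by rw [abs_of_neg (by linarith)]; ring, by linarith, by linarith⟩

theorem jacobiFunction_rearrangement_le {α β : ℝ} (hβ : -(1 / 2) ≤ β) (hα : -(1 / 2) < α) {l : ℂ}
    {θ : ℝ} (hθ0 : 0 ≤ θ) (hθ : θ < 1 / 2) (hl : |l.im| ≤ (1 - 2 * θ) * jacobiRho α β) :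
    ∃ K : ℝ, 0 < K ∧ ∀ t : ℝ, 0 < t →
      nonincreasingRearrangement (jacobiFunction α β l) (jacobiMeasure α β) t
        ≤ ENNReal.ofReal (K * t ^ (-θ)) := by
  have hρ : 0 < jacobiRho α β := by rw [jacobiRho]; linarith
  obtain ⟨C, hC⟩ := norm_jacobiFunction_le hα (mul_pos (by linarith) hρ) hl (by nlinarith)
  refine nonincreasingRearrangement_le_of_exp_decay hα hβ hθ0 (C := C) fun x hx => ?_
  convert hC x hx using 3
  ring

/-- On the closed strip `S_p` a Jacobi function is of weak type `p'`. -/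
theorem memLorentz_jacobiFunction_top {α β p : ℝ} (hβ : -(1 / 2) ≤ β) (hα : -(1 / 2) < α)
    (hp : 1 ≤ p) (hp2 : p < 2) {l : ℂ} (hl : l ∈ jacobiStrip α β p) :
    MemLorentz (jacobiFunction α β l) (ENNReal.conjExponent (ENNReal.ofReal p)) ⊤
      (jacobiMeasure α β) := by
  obtain ⟨h1, h2, h3⟩ := abs_one_sub_two_div hp hp2
  have hl' : |l.im| ≤ |1 - 2 / p| * jacobiRho α β := hl
  have e : 1 - 2 * (1 - 1 / p) = 2 / p - 1 := by ring
  obtain ⟨K, -, hK⟩ := jacobiFunction_rearrangement_le hβ hα (l := l) (θ := 1 - 1 / p)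
    (by linarith) (by linarith) (by rwa [e, ← h1])
  refine ⟨(continuous_jacobiFunction hα l).measurable, lorentzNorm_top_lt_top (K := K) ?_⟩
  rwa [toReal_inv_conjExponent hp]

theorem memLorentz_jacobiFunction_of_interior {α β p : ℝ} (hβ : -(1 / 2) ≤ β) (hα : -(1 / 2) < α)
    (hp : 1 < p) (hp2 : p < 2) {l : ℂ} (hl : l ∈ interior (jacobiStrip α β p)) {q : ℝ≥0∞}
    (hq : 1 ≤ q) :
    MemLorentz (jacobiFunction α β l) (ENNReal.conjExponent (ENNReal.ofReal p)) q
      (jacobiMeasure α β) := by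
  rcases eq_or_ne q ⊤ with rfl | hq'
  · exact memLorentz_jacobiFunction_top hβ hα hp.le hp2 (interior_subset hl)
  have hρ : 0 < jacobiRho α β := by rw [jacobiRho]; linarith
  obtain ⟨h1, h2, h3⟩ := abs_one_sub_two_div hp.le hp2
  have hl' : |l.im| < |1 - 2 / p| * jacobiRho α β := interior_jacobiStrip_subset α β p hl
  rw [h1] at hl'
  -- Since `l` lies strictly inside the strip, the rearrangement decays with an exponent `θ > 1 / p'`.
  obtain ⟨m, hm1, hm2⟩ := exists_between (max_lt ((div_lt_iff₀ hρ).2 hl') h2)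
  rw [max_lt_iff, div_lt_iff₀ hρ] at hm1
  have hp1 : 1 / p < 1 := by rw [div_lt_one (by linarith)]; exact hp
  have e : 2 / p = 2 * (1 / p) := by ring
  obtain ⟨K, hK, hKθ⟩ := jacobiFunction_rearrangement_le hβ hα (l := l) (θ := (1 - m) / 2)
    (by linarith) (by linarith) (by rw [show 1 - 2 * ((1 - m) / 2) = m by ring]; exact hm1.1.le)
  obtain ⟨K₀, hK₀, h0⟩ := jacobiFunction_rearrangement_le hβ hα (l := l) (θ := 0) le_rfl
    (by norm_num) (by nlinarith)
  refine ⟨(continuous_jacobiFunction hα l).measurable, lorentzNorm_lt_top hK₀.le hK.le hq hq'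
    (by rw [toReal_inv_conjExponent hp.le]; linarith)
    (by rw [toReal_inv_conjExponent hp.le]; linarith) (by simpa using h0) hKθ⟩

theorem memLorentz_jacobiFunction_div {α β : ℝ} (hβ : -(1 / 2) ≤ β) (hα : -(1 / 2) < α) (l : ℝ) :
    MemLorentz (fun x : ℝ => jacobiFunction α β (l : ℂ) x / (1 + (x : ℂ))) 2 ⊤
      (jacobiMeasure α β) := by
  have hρ : 0 < jacobiRho α β := by rw [jacobiRho]; linarith
  refine ⟨(continuous_jacobiFunction hα l).measurable.div (by fun_prop), ?_⟩
  obtain ⟨C, hC⟩ := norm_jacobiFunction_le_of_im_eq_zero hρ.le (Complex.ofReal_im l)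
  obtain ⟨K, -, hK⟩ := nonincreasingRearrangement_le_of_exp_decay hα hβ (C := C) (θ := 1 / 2)
    (f := fun x : ℝ => jacobiFunction α β (l : ℂ) x / (1 + (x : ℂ))) (by norm_num) fun x hx => by
      have h1 : ‖(1 : ℂ) + x‖ = 1 + x := by
        rw [← Complex.ofReal_one, ← Complex.ofReal_add, Complex.norm_real,
          Real.norm_of_nonneg (by linarith)]
      rw [norm_div, h1, div_le_iff₀ (by linarith)]
      refine (hC x hx.le).trans_eq ?_
      rw [show 2 * jacobiRho α β * (1 / 2) * x = jacobiRho α β * x by ring]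
      ring
  refine lorentzNorm_top_lt_top (K := K) ?_
  simpa using hK

theorem mainTheorem5 (α β : ℝ) (hβ : -(1 / 2) ≤ β) (hαβ : β ≤ α) (hα : -(1 / 2) < α) :
    (∀ p : ℝ, 1 < p → p < 2 → ∀ l ∈ interior (jacobiStrip α β p), ∀ q : ENNReal, 1 ≤ q →
      MemLorentz (jacobiFunction α β l) (ENNReal.conjExponent (ENNReal.ofReal p)) q
        (jacobiMeasure α β)) ∧
    (∀ p : ℝ, 1 ≤ p → p < 2 → ∀ l ∈ frontier (jacobiStrip α β p),
      MemLorentz (jacobiFunction α β l) (ENNReal.conjExponent (ENNReal.ofReal p)) ⊤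
        (jacobiMeasure α β)) ∧
    (∀ l : ℝ, MemLorentz (fun x : ℝ => jacobiFunction α β (l : ℂ) x / (1 + (x : ℂ))) 2 ⊤
      (jacobiMeasure α β)) :=
  ⟨fun _ hp hp2 _ hl _ hq => memLorentz_jacobiFunction_of_interior hβ hα hp hp2 hl hq,
    fun p hp hp2 _ hl =>
      memLorentz_jacobiFunction_top hβ hα hp hp2 (frontier_jacobiStrip_subset α β p hl),
    memLorentz_jacobiFunction_div hβ hα⟩
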